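/- Let $k<n$ and $\delta$ be positive integers such that $k\mid\delta$ or $(n-k)\mid\delta$. Then there is an integer $N$, depending only on $n,k,\delta$, such that over every finite field $\mathbb F$ with $|\mathbb F|\ge N$ there exists an $(n,k,\delta)$ convolutional code with a maximum distance profile. Here an $(n,k,\delta)$ convolutional code over $\mathbb F$ is the set $\mathcal C$ of all sequences $v_t=\binom{y_t}{u_t}\in\mathbb F^n$, $t=0,1,2,\dots$, generated by a linear system $$x_{t+1}=Ax_t+Bu_t,\qquad y_t=Cx_t+Du_t,\qquad x_0=0,$$ with $A\in\mathbb F^{\delta\times\delta}$, $B\in\mathbb F^{\delta\times k}$, $C\in\mathbb F^{(n-k)\times\delta}$, $D\in\mathbb F^{(n-k)\times k}$, where $(A,B)$ is controllable (that is, $[B\; AB\;\cdots\;A^{\delta-1}B]$ has rank $\delta$) and $(A,C)$ is observable (that is, the matrix with block rows $C,CA,\dots,CA^{\delta-1}$ has rank $\delta$). Writing $\mathrm{wt}$ for the number of nonzero components of a vector, the $j$-th column distance of $\mathcal C$ is $$d_j=\min\Big\{\sum_{t=0}^{j}\mathrm{wt}(u_t)+\sum_{t=0}^{j}\mathrm{wt}(y_t)\;:\;(v_t)_{t\ge0}\in\mathcal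 C,\ u_0\neq0\Big\},$$ and $\mathcal C$ has a maximum distance profile if $$d_j=(n-k)(j+1)+1\quad\text{for } j=0,1,\dots,L,\qquad L=\Big\lfloor\frac{\delta}{k}\Big\rfloor+\Big\lfloor\frac{\delta}{n-k}\Big\rfloor.$$ -/

import Mathlib

open Matrix

/-- A time-invariant linear system over `F` with `k` inputs, `n - k` outputs and `δ` states:
`x (t+1) = A x t + B u t`, `y t = C x t + D u t`. -/
structure LinearSystem (F : Type*) (n k δ : ℕ) where
  A : Matrix (Fin δ) (Fin δ) F
  B : Matrix (Fin δ) (Fin k) F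
  C : Matrix (Fin (n - k)) (Fin δ) F
  D : Matrix (Fin (n - k)) (Fin k) F

/-- Sequences of code vectors. The vector at time `t` is the stack of the parity vector
(left summand) and the information vector (right summand); it has `(n - k) + k = n` entries. -/
abbrev CodeSeq (F : Type*) (n k : ℕ) : Type _ := ℕ → Fin (n - k) ⊕ Fin k → F

namespace CodeSeq

variable {F : Type*} {n k : ℕ}

/-- The parity vector `y t`. -/
def parity (v : CodeSeq F n k) (t : ℕ) : Fin (n - k) → F := fun i => v t (Sum.inl i)

/-- The information vector `u t`. -/
def info (v : CodeSeq F n k) (t : ℕ) : Fin k → F := fun i => v t (Sum.inr i)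

end CodeSeq

namespace LinearSystem

variable {F : Type*} [Field F] {n k δ : ℕ}

/-- The set of all code sequences of the system started in the state `0`. -/
def code (S : LinearSystem F n k δ) : Set (CodeSeq F n k) :=
  {v | ∃ x : ℕ → Fin δ → F, x 0 = 0 ∧ ∀ t,
    x (t + 1) = S.A *ᵥ x t + S.B *ᵥ v.info t ∧
    v.parity t = S.C *ᵥ x t + S.D *ᵥ v.info t}

/-- The controllability matrix `[B, AB, …, A^(δ-1) B]`. -/
def controllabilityMatrix (S : LinearSystem F n k δ) :
    Matrix (Fin δ) (Fin δ × Fin k) F :=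
  Matrix.of fun i p => (S.A ^ (p.1 : ℕ) * S.B) i p.2

/-- The observability matrix with block rows `C, CA, …, C A^(δ-1)`. -/
def observabilityMatrix (S : LinearSystem F n k δ) :
    Matrix (Fin δ × Fin (n - k)) (Fin δ) F :=
  Matrix.of fun p i => (S.C * S.A ^ (p.1 : ℕ)) p.2 i

/-- `(A, B)` is a controllable pair. -/
def IsControllable (S : LinearSystem F n k δ) : Prop :=
  S.controllabilityMatrix.rank = δ

/-- `(A, C)` is an observable pair. -/
def IsObservable (S : LinearSystem F n k δ) : Prop :=
  S.observabilityMatrix.rank = δ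

end LinearSystem

/-- An `(n, k, δ)` convolutional code: the code generated by a controllable and observable
system with `δ` states. -/
def IsConvolutionalCode {F : Type*} [Field F] (n k δ : ℕ) (𝒞 : Set (CodeSeq F n k)) : Prop :=
  ∃ S : LinearSystem F n k δ, S.IsControllable ∧ S.IsObservable ∧ S.code = 𝒞

/-- The `j`-th column distance: the least value of `∑_{t ≤ j} wt (u t) + ∑_{t ≤ j} wt (y t)`
over all code sequences with `u 0 ≠ 0`. The infimum is taken in `ℕ`, so it is a minimum as
soon as such a sequence exists, which is always so for `0 < k`. -/
noncomputable def columnDistance {F : Type*} [Field F] [DecidableEq F] {n k : ℕ}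
    (𝒞 : Set (CodeSeq F n k)) (j : ℕ) : ℕ :=
  sInf {w | ∃ v ∈ 𝒞, v.info 0 ≠ 0 ∧
    w = ∑ t ∈ Finset.range (j + 1), hammingNorm (v.info t) +
      ∑ t ∈ Finset.range (j + 1), hammingNorm (v.parity t)}

/-- The code `𝒞`, of length `n`, dimension `k` and degree `δ`, has a maximum distance profile:
`d_j = (n - k) (j + 1) + 1` for `0 ≤ j ≤ L = ⌊δ / k⌋ + ⌊δ / (n - k)⌋`. -/
def HasMaximumDistanceProfile {F : Type*} [Field F] [DecidableEq F] {n k : ℕ}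
    (δ : ℕ) (𝒞 : Set (CodeSeq F n k)) : Prop :=
  ∀ j ≤ δ / k + δ / (n - k), columnDistance 𝒞 j = (n - k) * (j + 1) + 1

/-! With `m = n - k`, choose Markov parameters `G i` with entries `t ^ (n i + α - β) ^ 2`. In their
lower block triangular Toeplitz matrix, the nonzero entries are `t` to the squared difference of row
and column positions. By the rearrangement inequality every nontrivial minor, as a polynomial in
`t`, has one term of least degree, with coefficient `±1`; so it is nonzero in every characteristic.
The finitely many minors have degrees independent of the field, so a large field has a `t` at which
none vanishes (`exists_isSuperregular`).

Superregularity forces the optimal weights: too light a codeword would put a nonzero vector in the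
kernel of a nontrivial submatrix (`IsSuperregular.lt_weight`).

It remains to realize `G 0, …, G L` by a controllable and observable system with `δ` states. If `k ∣
δ`, a block companion matrix does this once a `δ × δ` Hankel matrix is invertible
(`exists_partial_realization`), and its determinant is a Toeplitz minor up to column order. If `(n -
k) ∣ δ`, the transposed parameters are realized and the system is dualized. -/

open Polynomial in
/-- If the exponents `(R i - C j) ^ 2` come from strictly increasing sequences, the diagonal term is
the only term of least degree in the Leibniz expansion, whatever off-diagonal entries are erased. -/
theorem det_X_pow_sq_ne_zero {S : Type*} [CommRing S] [Nontrivial S] {p : ℕ} (R C : Fin p → ℤ)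
    (hR : StrictMono R) (hC : StrictMono C) (M : Matrix (Fin p) (Fin p) S[X])
    (hM : ∀ i j, M i j = X ^ ((R i - C j) ^ 2).natAbs ∨ M i j = 0)
    (hdiag : ∀ i, M i i = X ^ ((R i - C i) ^ 2).natAbs) : M.det ≠ 0 := by
  classical
  have key : M.det.coeff (∑ i, ((R i - C i) ^ 2).natAbs) = 1 := by
    rw [Matrix.det_apply, Polynomial.finsetSum_coeff,
      Finset.sum_eq_single_of_mem (1 : Equiv.Perm (Fin p)) (Finset.mem_univ _)]
    · simp [hdiag, Finset.prod_pow_eq_pow_sum, coeff_X_pow]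
    · intro σ _ hσ
      suffices h : (∏ i, M (σ i) i).coeff (∑ i, ((R i - C i) ^ 2).natAbs) = 0 by
        rcases Int.units_eq_one_or (Equiv.Perm.sign σ) with h1 | h1
        · rw [h1, one_smul, h]
        · rw [h1, Units.neg_smul, one_smul, coeff_neg, h, neg_zero]
      by_cases hz : ∃ i, M (σ i) i = 0
      · obtain ⟨i, hi⟩ := hz
        rw [Finset.prod_eq_zero (f := fun i => M (σ i) i) (Finset.mem_univ i) hi, coeff_zero]
      · push Not at hz
        have h1 : ∀ i, M (σ i) i = X ^ ((R (σ i) - C i) ^ 2).natAbs := fun i =>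
          (hM (σ i) i).resolve_right (hz i)
        simp only [h1, Finset.prod_pow_eq_pow_sum, coeff_X_pow]
        rw [if_neg]
        have hmono : Monovary R C := fun i j hij => hR.monotone (hC.lt_iff_lt.1 hij).le
        -- Equality in the rearrangement inequality would make `σ` monotone, hence the identity.
        have hlt : ∑ i, R (σ i) * C i < ∑ i, R i * C i := by
          rw [hmono.sum_comp_perm_mul_lt_sum_mul_iff]
          intro hmv
          apply hσ
          have hs : StrictMono σ := by
            have hm : Monotone σ := by
              intro i j hij
              rcases hij.eq_or_lt with h | h
              · rw [h]
              · exact hR.le_iff_le.1 (hmv (hC h))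
            exact hm.strictMono_of_injective σ.injective
          have := Subsingleton.elim (hs.orderIsoOfSurjective σ σ.surjective) (OrderIso.refl _)
          ext i
          exact congrArg Fin.val (DFunLike.congr_fun this i)
        have hsq : ∑ i, (R (σ i)) ^ 2 = ∑ i, (R i) ^ 2 := Equiv.sum_comp σ fun i => (R i) ^ 2
        -- Permuting changes only the cross term of the squares.
        have hgt : ∑ i, (R i - C i) ^ 2 < ∑ i, (R (σ i) - C i) ^ 2 := by
          have e1 : ∀ f : Fin p → ℤ, ∑ i, (f i - C i) ^ 2
              = ∑ i, f i ^ 2 + ∑ i, C i ^ 2 - 2 * ∑ i, f i * C i := by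
            intro f
            rw [Finset.mul_sum, ← Finset.sum_add_distrib, ← Finset.sum_sub_distrib]
            exact Finset.sum_congr rfl fun i _ => by ring
          rw [e1 R, e1 fun i => R (σ i)]
          linarith
        intro heq
        have h2 := congrArg (Nat.cast : ℕ → ℤ) heq
        push_cast [Int.natCast_natAbs, abs_sq] at h2
        exact hgt.ne h2
  intro h0
  rw [h0, coeff_zero] at key
  exact zero_ne_one key

/-! ### Superregular block Toeplitz matrices -/

section Toeplitz

variable {S : Type*} [CommRing S] {m k : ℕ}

/-- The Markov parameters `t ^ (K i + α - β) ^ 2`. -/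
def markovParam (K : ℕ) (m k : ℕ) (t : S) (i : ℕ) : Matrix (Fin m) (Fin k) S :=
  Matrix.of fun α β => t ^ (((K * i + α - β : ℤ)) ^ 2).natAbs

/-- The entries of the lower block triangular Toeplitz matrix of the Markov parameters. Rows and
columns are pairs of a time and a component. -/
def toeplitzEntry (K : ℕ) (t : S) (x : ℕ × Fin m) (y : ℕ × Fin k) : S :=
  if y.1 ≤ x.1 then markovParam K m k t (x.1 - y.1) x.2 y.2 else 0

/-- The minor with rows `R` and columns `C`. -/
def toeplitzMinor (K : ℕ) (t : S) {p : ℕ} (R : Fin p → ℕ × Fin m) (C : Fin p → ℕ × Fin k) : S :=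
  (Matrix.of fun i j => toeplitzEntry K t (R i) (C j)).det

/-- Rows and columns of a square submatrix whose determinant is not forced to vanish by the
triangular shape. -/
structure IsNontrivialPair {p : ℕ} (R : Fin p → ℕ × Fin m) (C : Fin p → ℕ × Fin k) : Prop where
  injR : Function.Injective R
  injC : Function.Injective C
  count : ∀ r, (Finset.univ.filter fun i => (R i).1 < r).card ≤
    (Finset.univ.filter fun i => (C i).1 < r).card

theorem map_toeplitzMinor {S' : Type*} [CommRing S'] (f : S →+* S') (K : ℕ) (t : S) {p : ℕ}
    (R : Fin p → ℕ × Fin m) (C : Fin p → ℕ × Fin k) :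
    f (toeplitzMinor K t R C) = toeplitzMinor K (f t) R C := by
  unfold toeplitzMinor
  rw [RingHom.map_det]
  congr 1
  ext i j
  simp only [RingHom.mapMatrix_apply, Matrix.map_apply, Matrix.of_apply, toeplitzEntry,
    markovParam]
  split_ifs <;> simp

/-- The position of a pair of a time and a component in the lexicographic order. -/
def position (K : ℕ) {m : ℕ} (x : ℕ × Fin m) : ℤ := K * x.1 + x.2

theorem fst_le_of_position_le {K : ℕ} (hm : m ≤ K) {x y : ℕ × Fin m}
    (h : position K x ≤ position K y) : x.1 ≤ y.1 := by
  by_contra! hlt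
  have h1 : (y.1 : ℤ) + 1 ≤ x.1 := by exact_mod_cast hlt
  have h2 := y.2.2
  have h3 : (K : ℤ) * (y.1 + 1) ≤ K * x.1 := mul_le_mul_of_nonneg_left h1 (by positivity)
  simp only [position] at h
  have h4 : ((y.2 : ℕ) : ℤ) < K := by exact_mod_cast h2.trans_le hm
  have h5 : (0 : ℤ) ≤ ((x.2 : ℕ) : ℤ) := by positivity
  linarith

theorem position_injective {K : ℕ} (hm : m ≤ K) :
    Function.Injective (position K : ℕ × Fin m → ℤ) := by
  intro x y h
  have h1 : x.1 = y.1 :=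
    le_antisymm (fst_le_of_position_le hm h.le) (fst_le_of_position_le hm h.ge)
  simp only [position, h1] at h
  exact Prod.ext h1 (Fin.ext (by exact_mod_cast add_left_cancel h))

-- Sorting rows and columns by `position` changes the minor only by a sign and brings it into the
-- form of `det_X_pow_sq_ne_zero`.
open Polynomial in
theorem toeplitzMinor_X_ne_zero [Nontrivial S] {K : ℕ} (hm : m ≤ K) (hk : k ≤ K) {p : ℕ}
    {R : Fin p → ℕ × Fin m} {C : Fin p → ℕ × Fin k} (h : IsNontrivialPair R C) :
    toeplitzMinor K (X : S[X]) R C ≠ 0 := by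
  classical
  have sorted : ∀ {l : ℕ} (_ : l ≤ K) (f : Fin p → ℕ × Fin l), Function.Injective f →
      ∃ σ : Equiv.Perm (Fin p), StrictMono fun i => position K (f (σ i)) := by
    intro l hl f hf
    refine ⟨Tuple.sort fun i => position K (f i), ?_⟩
    exact (Tuple.monotone_sort fun i => position K (f i)).strictMono_of_injective
      (((position_injective hl).comp hf).comp (Equiv.injective _))
  obtain ⟨σ, hσ⟩ := sorted hm R h.injR
  obtain ⟨τ, hτ⟩ := sorted hk C h.injC
  set M : Matrix (Fin p) (Fin p) S[X] := Matrix.of fun i j => toeplitzEntry K X (R i) (C j)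
    with hMdef
  have hentry : ∀ x : ℕ × Fin m, ∀ y : ℕ × Fin k, y.1 ≤ x.1 →
      toeplitzEntry K (X : S[X]) x y = X ^ ((position K x - position K y) ^ 2).natAbs := by
    intro x y hxy
    simp only [toeplitzEntry, hxy, if_true, markovParam, Matrix.of_apply, position]
    rw [Nat.cast_sub hxy]
    congr 3
    ring
  -- Nontriviality keeps the sorted diagonal inside the nonzero blocks: otherwise at least `l + 1`
  -- rows, but at most `l` columns, would have time at most that of row `σ l`.
  have hle : ∀ l, (C (τ l)).1 ≤ (R (σ l)).1 := by
    intro l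
    by_contra! hlt
    have h1 : (Finset.univ.filter fun i => i ≤ l).card ≤
        (Finset.univ.filter fun i => (R i).1 < (R (σ l)).1 + 1).card := by
      apply Finset.card_le_card_of_injOn σ
      · intro i hi
        have hi : i ≤ l := by simpa using hi
        simpa [Nat.lt_succ_iff] using fst_le_of_position_le hm (hσ.monotone hi)
      · exact σ.injective.injOn
    have h2 : (Finset.univ.filter fun i => (C i).1 < (R (σ l)).1 + 1).card ≤
        (Finset.univ.filter fun i => i < l).card := by
      apply Finset.card_le_card_of_injOn τ.symm
      · intro i hi
        have hi : (C i).1 < (R (σ l)).1 + 1 := by simpa using hi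
        simp only [Finset.coe_filter, Finset.mem_univ, true_and, Set.mem_ofPred_eq]
        by_contra! hge
        have := fst_le_of_position_le hk (hτ.monotone hge)
        simp only [Equiv.apply_symm_apply] at this
        omega
      · exact τ.symm.injective.injOn
    have h3 := h.count ((R (σ l)).1 + 1)
    have h4 : (Finset.univ.filter fun i => i < l).card <
        (Finset.univ.filter fun i => i ≤ l).card := by
      apply Finset.card_lt_card
      refine ⟨fun i hi => ?_, fun hsub => ?_⟩
      · simp only [Finset.mem_filter, Finset.mem_univ, true_and] at hi ⊢
        exact hi.le
      · have : l ∈ Finset.univ.filter fun i => i < l := hsub (by simp)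
        simp at this
    omega
  have hdet : (M.submatrix σ τ).det ≠ 0 := by
    refine det_X_pow_sq_ne_zero _ _ hσ hτ _ (fun i j => ?_) fun i => hentry _ _ (hle i)
    by_cases hij : (C (τ j)).1 ≤ (R (σ i)).1
    · exact Or.inl (hentry _ _ hij)
    · exact Or.inr (if_neg hij)
  intro h0
  apply hdet
  change M.det = 0 at h0
  have : M.submatrix σ τ = (M.submatrix σ id).submatrix id τ := by
    rw [Matrix.submatrix_submatrix]; rfl
  rw [this, Matrix.det_permute', Matrix.det_permute, h0]
  simp

/-- All nontrivial minors of the Toeplitz matrix with times below `T` are nonzero. -/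
def IsSuperregular (K m k T : ℕ) (t : S) : Prop :=
  ∀ (p : ℕ) (R : Fin p → ℕ × Fin m) (C : Fin p → ℕ × Fin k), IsNontrivialPair R C →
    (∀ i, (R i).1 < T) → (∀ i, (C i).1 < T) → toeplitzMinor K t R C ≠ 0

end Toeplitz

open Polynomial in
theorem exists_isSuperregular {K m k : ℕ} (hm : m ≤ K) (hk : k ≤ K) (T : ℕ) :
    ∃ N : ℕ, ∀ (F : Type*) [Field F] [Fintype F], N ≤ Fintype.card F →
      ∃ t : F, IsSuperregular K m k T t := by
  classical
  let J := Σ p : Fin (T * m + 1), (Fin p → Fin T × Fin m) × (Fin p → Fin T × Fin k)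
  let rows : (x : J) → Fin x.1 → ℕ × Fin m := fun x i => ((x.2.1 i).1, (x.2.1 i).2)
  let cols : (x : J) → Fin x.1 → ℕ × Fin k := fun x i => ((x.2.2 i).1, (x.2.2 i).2)
  let s : Finset J := Finset.univ.filter fun x => IsNontrivialPair (rows x) (cols x)
  -- Taken over `ℤ`, so that its degree bounds the number of bad `t` in all fields at once.
  let P : ℤ[X] := ∏ x ∈ s, toeplitzMinor K X (rows x) (cols x)
  refine ⟨P.natDegree + 1, fun F _ _ hF => ?_⟩
  have hP : P.map (Int.castRingHom F) = ∏ x ∈ s, toeplitzMinor K X (rows x) (cols x) := by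
    rw [Polynomial.map_prod]
    refine Finset.prod_congr rfl fun x _ => ?_
    have := map_toeplitzMinor (Polynomial.mapRingHom (Int.castRingHom F)) K X (rows x) (cols x)
    simpa using this
  have hne : P.map (Int.castRingHom F) ≠ 0 := by
    rw [hP, Finset.prod_ne_zero_iff]
    intro x hx
    exact toeplitzMinor_X_ne_zero hm hk (Finset.mem_filter.1 hx).2
  obtain ⟨t, ht⟩ := Polynomial.exists_eval_ne_zero_of_natDegree_lt_card _ hne (by
    rw [Cardinal.mk_fintype]
    exact_mod_cast lt_of_le_of_lt natDegree_map_le (Nat.lt_of_succ_le hF))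
  refine ⟨t, fun p R C hRC hR hC => ?_⟩
  rw [hP, Polynomial.eval_prod, Finset.prod_ne_zero_iff] at ht
  -- Injectivity of the rows bounds the size of a minor, so `J` covers them all.
  have hp : p < T * m + 1 := by
    have hinj : Function.Injective fun i => ((⟨(R i).1, hR i⟩, (R i).2) : Fin T × Fin m) := by
      intro i j hij
      simp only [Prod.mk.injEq, Fin.mk.injEq] at hij
      exact hRC.injR (Prod.ext hij.1 hij.2)
    have := Fintype.card_le_of_injective _ hinj
    simp at this
    omega
  have := ht ⟨⟨p, hp⟩, fun i => (⟨(R i).1, hR i⟩, (R i).2), fun i => (⟨(C i).1, hC i⟩, (C i).2)⟩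
    (Finset.mem_filter.2 ⟨Finset.mem_univ _, hRC⟩)
  rw [← Polynomial.coe_evalRingHom, map_toeplitzMinor] at this
  simpa using this

/-! ### Superregularity and weights -/

/-- A nonzero input whose support is no larger than the zero set of the output would give a singular
nontrivial minor. -/
theorem IsSuperregular.eq_zero {F : Type*} [Field F] {K m k T : ℕ} {t : F}
    (ht : IsSuperregular K m k T t) (J : Finset (ℕ × Fin m)) (I : Finset (ℕ × Fin k))
    (hcard : J.card = I.card) (hJ : ∀ x ∈ J, x.1 < T) (hI : ∀ y ∈ I, y.1 < T)
    (hcount : ∀ r, (J.filter fun x => x.1 < r).card ≤ (I.filter fun y => y.1 < r).card)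
    (u : ℕ × Fin k → F) (hu : ∀ x ∈ J, ∑ y ∈ I, toeplitzEntry K t x y * u y = 0) :
    ∀ y ∈ I, u y = 0 := by
  classical
  let f : Fin J.card ≃ J := J.equivFin.symm
  let g : Fin J.card ≃ I := (I.equivFinOfCardEq hcard.symm).symm
  have hcf : ∀ r, (Finset.univ.filter fun i => ((f i : ℕ × Fin m)).1 < r).card =
      (J.filter fun x => x.1 < r).card := by
    intro r
    refine Finset.card_bij (fun i _ => (f i : ℕ × Fin m)) ?_ ?_ ?_
    · intro i hi; simp at hi ⊢; exact hi
    · intro i _ j _ h; exact f.injective (Subtype.ext h)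
    · intro x hx
      simp only [Finset.mem_filter] at hx
      exact ⟨f.symm ⟨x, hx.1⟩, by simp [hx.2], by simp⟩
  have hcg : ∀ r, (Finset.univ.filter fun i => ((g i : ℕ × Fin k)).1 < r).card =
      (I.filter fun x => x.1 < r).card := by
    intro r
    refine Finset.card_bij (fun i _ => (g i : ℕ × Fin k)) ?_ ?_ ?_
    · intro i hi; simp at hi ⊢; exact hi
    · intro i _ j _ h; exact g.injective (Subtype.ext h)
    · intro x hx
      simp only [Finset.mem_filter] at hx
      exact ⟨g.symm ⟨x, hx.1⟩, by simp [hx.2], by simp⟩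
  have hdet := ht J.card (fun i => f i) (fun i => g i)
    ⟨Subtype.val_injective.comp f.injective, Subtype.val_injective.comp g.injective,
      fun r => by rw [hcf, hcg]; exact hcount r⟩
    (fun i => hJ _ (f i).2) (fun i => hI _ (g i).2)
  have hz : (fun i => u (g i)) = 0 := by
    by_contra hne
    apply hdet
    rw [toeplitzMinor, ← Matrix.exists_mulVec_eq_zero_iff]
    refine ⟨_, hne, ?_⟩
    ext i
    simp only [Matrix.mulVec, dotProduct, Matrix.of_apply, Pi.zero_apply]
    rw [Equiv.sum_comp g fun y : I => toeplitzEntry K t (f i : ℕ × Fin m) (y : ℕ × Fin k) * u y,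
      Finset.sum_coe_sort I fun y => toeplitzEntry K t (f i : ℕ × Fin m) (y : ℕ × Fin k) * u y]
    exact hu _ (f i).2
  intro y hy
  have := congrFun hz (g.symm ⟨y, hy⟩)
  simpa using this

/-- The weight bound for the input-output pairs of a superregular Toeplitz matrix. -/
theorem IsSuperregular.lt_weight {F : Type*} [Field F] [DecidableEq F] {K m k T : ℕ} {t : F}
    (ht : IsSuperregular K m k T t) (u : ℕ → Fin k → F) (y : ℕ → Fin m → F) (hu : u 0 ≠ 0)
    (hy : ∀ a < T, y a = ∑ b ∈ Finset.range (a + 1), markovParam K m k t (a - b) *ᵥ u b)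
    {j : ℕ} (hj : j < T) :
    m * (j + 1) < ∑ a ∈ Finset.range (j + 1), hammingNorm (u a) +
      ∑ a ∈ Finset.range (j + 1), hammingNorm (y a) := by
  classical
  by_contra! hle
  let I : ℕ → Finset (ℕ × Fin k) := fun s =>
    (Finset.range s ×ˢ Finset.univ).filter fun x => u x.1 x.2 ≠ 0
  let J : ℕ → Finset (ℕ × Fin m) := fun s =>
    (Finset.range s ×ˢ Finset.univ).filter fun x => y x.1 x.2 = 0
  have hIcard : ∀ s, (I s).card = ∑ a ∈ Finset.range s, hammingNorm (u a) := by
    intro s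
    simp only [I, Finset.card_filter, Finset.sum_product, hammingNorm]
  have hJcard : ∀ s, (J s).card + ∑ a ∈ Finset.range s, hammingNorm (y a) = m * s := by
    intro s
    have : ∑ a ∈ Finset.range s, hammingNorm (y a) =
        ((Finset.range s ×ˢ (Finset.univ : Finset (Fin m))).filter
          fun x => ¬ y x.1 x.2 = 0).card := by
      simp only [Finset.card_filter, Finset.sum_product, hammingNorm, ne_eq]
    rw [this, Finset.card_filter_add_card_filter_not]
    simp [mul_comm]
  have hImono : ∀ {r s}, r ≤ s → I r ⊆ I s := fun h =>
    Finset.filter_subset_filter _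
      (Finset.product_subset_product_left (Finset.range_subset_range.2 h))
  have hJmono : ∀ {r s}, r ≤ s → J r ⊆ J s := fun h =>
    Finset.filter_subset_filter _
      (Finset.product_subset_product_left (Finset.range_subset_range.2 h))
  -- At the first time when output zeros are at least as many as nonzero inputs, minimality supplies
  -- the counting condition at all earlier times.
  have hex : ∃ s, (I (s + 1)).card ≤ (J (s + 1)).card := by
    refine ⟨j, ?_⟩
    have h1 := hIcard (j + 1)
    have h2 := hJcard (j + 1)
    omega
  set s := Nat.find hex with hs
  have hs1 : (I (s + 1)).card ≤ (J (s + 1)).card := Nat.find_spec hex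
  have hsj : s ≤ j := Nat.find_min' hex (by
    have h1 := hIcard (j + 1)
    have h2 := hJcard (j + 1)
    omega)
  have hmin : ∀ r ≤ s, (J r).card ≤ (I r).card := by
    intro r hr
    rcases r with _ | r
    · simp [J]
    · have := Nat.find_min hex (m := r) (by omega)
      omega
  -- Surplus zeros are discarded to make the submatrix square.
  obtain ⟨J', hJ1, hJ2, hJ'⟩ := Finset.exists_subsuperset_card_eq (hJmono (Nat.le_succ s))
    ((hmin s le_rfl).trans (Finset.card_le_card (hImono (Nat.le_succ s)))) hs1
  have hzero := ht.eq_zero J' (I (s + 1)) hJ'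
    (fun x hx => by
      have := hJ2 hx
      simp [J] at this
      omega)
    (fun x hx => by
      simp [I] at hx
      omega)
    (fun r => by
      by_cases hr : r ≤ s
      · calc _ ≤ (J r).card := Finset.card_le_card fun x hx => by
              simp only [Finset.mem_filter] at hx
              have := hJ2 hx.1
              simp [J] at this ⊢
              exact ⟨hx.2, this.2⟩
          _ ≤ (I r).card := hmin r hr
          _ ≤ _ := Finset.card_le_card fun x hx => by
              simp [I] at hx ⊢
              exact ⟨⟨by omega, hx.2⟩, hx.1⟩
      · calc _ ≤ J'.card := Finset.card_filter_le _ _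
          _ = (I (s + 1)).card := hJ'
          _ ≤ _ := Finset.card_le_card fun x hx => by
              simp [I] at hx ⊢
              exact ⟨hx, by omega⟩)
    (fun x => u x.1 x.2)
    (fun x hx => by
      have hx' := hJ2 hx
      simp only [J, Finset.mem_filter, Finset.mem_product, Finset.mem_range, Finset.mem_univ,
        and_true] at hx'
      rw [← hx'.2, hy _ (by omega), Finset.sum_apply]
      have h1 : ∑ z ∈ I (s + 1), toeplitzEntry K t x z * u z.1 z.2 =
          ∑ z ∈ Finset.range (s + 1) ×ˢ Finset.univ, toeplitzEntry K t x z * u z.1 z.2 := by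
        rw [Finset.sum_filter]
        refine Finset.sum_congr rfl fun z _ => ?_
        split_ifs with h
        · rfl
        · push Not at h; rw [h, mul_zero]
      rw [h1, Finset.sum_product]
      symm
      rw [← Finset.sum_subset (Finset.range_subset_range.2 (Nat.succ_le_of_lt hx'.1))]
      · refine Finset.sum_congr rfl fun b hb => ?_
        have hb : b ≤ x.1 := by simpa [Nat.lt_succ_iff] using hb
        simp [Matrix.mulVec, dotProduct, toeplitzEntry, hb]
      · intro b _ hb
        have hb : ¬ b ≤ x.1 := by simpa [Nat.lt_succ_iff] using hb
        simp [toeplitzEntry, hb])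
  apply hu
  ext β
  by_contra hne
  exact hne (hzero (0, β) (by simp [I]; exact hne))

/-! ### Column distances of a linear system -/

namespace LinearSystem

variable {F : Type*} [Field F] {n k δ : ℕ}

/-- The output is the convolution of the input with the Markov parameters. -/
theorem parity_eq_sum (S : LinearSystem F n k δ) {L : ℕ} (G : ℕ → Matrix (Fin (n - k)) (Fin k) F)
    (hD : S.D = G 0) (hG : ∀ r < L, S.C * S.A ^ r * S.B = G (r + 1)) {v : CodeSeq F n k}
    (hv : v ∈ S.code) {a : ℕ} (ha : a < L + 1) :
    v.parity a = ∑ b ∈ Finset.range (a + 1), G (a - b) *ᵥ v.info b := by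
  obtain ⟨x, hx0, hx⟩ := hv
  have hstate : ∀ a, x a = ∑ b ∈ Finset.range a, (S.A ^ (a - 1 - b) * S.B) *ᵥ v.info b := by
    intro a
    induction a with
    | zero => simp [hx0]
    | succ a ih =>
      rw [(hx a).1, ih, Finset.sum_range_succ, Matrix.mulVec_sum]
      congr 1
      · refine Finset.sum_congr rfl fun b hb => ?_
        have hb := Finset.mem_range.1 hb
        rw [Matrix.mulVec_mulVec, ← Matrix.mul_assoc, ← pow_succ']
        congr 3
        omega
      · simp
  rw [(hx a).2, hstate, Finset.sum_range_succ, Matrix.mulVec_sum]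
  congr 1
  · refine Finset.sum_congr rfl fun b hb => ?_
    have hb := Finset.mem_range.1 hb
    rw [Matrix.mulVec_mulVec, ← Matrix.mul_assoc, hG _ (by omega)]
    congr 2
    omega
  · simp [hD]

/-- Every input sequence occurs in the code. -/
theorem exists_mem_code (S : LinearSystem F n k δ) (u : ℕ → Fin k → F) :
    ∃ v ∈ S.code, v.info = u := by
  let x : ℕ → Fin δ → F := fun t => Nat.rec (0 : Fin δ → F) (fun t x => S.A *ᵥ x + S.B *ᵥ u t) t
  exact ⟨fun t => Sum.elim (S.C *ᵥ x t + S.D *ᵥ u t) (u t), ⟨x, rfl, fun t => ⟨rfl, rfl⟩⟩, rfl⟩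

/-- A unit impulse has input weight 1 and at most `n - k` nonzero outputs at each time, which gives
the upper bound; `IsSuperregular.lt_weight` gives the lower one. -/
theorem hasMaximumDistanceProfile [DecidableEq F] (hk : 0 < k) (S : LinearSystem F n k δ)
    {K : ℕ} {t : F} (hD : S.D = markovParam K (n - k) k t 0)
    (hG : ∀ r < δ / k + δ / (n - k), S.C * S.A ^ r * S.B = markovParam K (n - k) k t (r + 1))
    (ht : IsSuperregular K (n - k) k (δ / k + δ / (n - k) + 1) t) :
    HasMaximumDistanceProfile δ S.code := by
  intro j hj
  apply le_antisymm
  · obtain ⟨v, hv, hvu⟩ := S.exists_mem_code (Pi.single 0 (Pi.single ⟨0, hk⟩ 1))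
    have hv0 : v.info 0 ≠ 0 := by simp [hvu]
    refine le_trans (Nat.sInf_le (Set.mem_ofPred.2 ⟨v, hv, hv0, rfl⟩)) ?_
    have h1 : ∑ t ∈ Finset.range (j + 1), hammingNorm (v.info t) ≤ 1 := by
      rw [Finset.sum_eq_single_of_mem 0 (by simp)]
      · rw [hvu, hammingNorm, Finset.card_le_one]
        intro a ha b hb
        simp [Pi.single_apply] at ha hb
        rw [ha, hb]
      · intro b _ hb
        simp [hvu, hb]
    have h2 : ∑ t ∈ Finset.range (j + 1), hammingNorm (v.parity t) ≤ (j + 1) * (n - k) := by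
      calc _ ≤ ∑ t ∈ Finset.range (j + 1), (n - k) := Finset.sum_le_sum fun t _ => by
            simpa using hammingNorm_le_card_fintype (x := v.parity t)
        _ = _ := by simp
    rw [mul_comm (n - k)]
    omega
  · apply le_csInf
    · obtain ⟨v, hv, hvu⟩ := S.exists_mem_code (Pi.single 0 (Pi.single ⟨0, hk⟩ 1))
      exact ⟨_, v, hv, by simp [hvu], rfl⟩
    · rintro w ⟨v, hv, hv0, rfl⟩
      exact ht.lt_weight (fun t => v.info t) (fun t => v.parity t) hv0
        (fun a ha => S.parity_eq_sum _ hD hG hv ha) (Nat.lt_succ_of_le hj)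

end LinearSystem

/-! ### Partial realization with `δ` states -/

/-- A square Hankel matrix of Markov parameters: its rows are the first `δ` pairs of a shift and an
output component, its columns the pairs of a delay and an input component. -/
def hankel {F : Type*} {m k q δ : ℕ} (hm : 0 < m) (e : Fin δ ≃ Fin q × Fin k)
    (G : ℕ → Matrix (Fin m) (Fin k) F) : Matrix (Fin δ) (Fin δ) F :=
  Matrix.of fun p s => G ((e s).1 + p / m + 1) ⟨p % m, Nat.mod_lt _ hm⟩ (e s).2

/-- Partial realization: if the Hankel matrix is invertible, a block companion matrix realizes the
parameters `G 1, …, G (q + δ / m)` with `δ` states. -/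
theorem exists_partial_realization {F : Type*} [Field F] {m k q δ : ℕ} (hm : 0 < m) (hk : 0 < k)
    (hq : 0 < q) (e : Fin δ ≃ Fin q × Fin k) (G : ℕ → Matrix (Fin m) (Fin k) F)
    (hG : (hankel hm e G).det ≠ 0) :
    ∃ (A : Matrix (Fin δ) (Fin δ) F) (B : Matrix (Fin δ) (Fin k) F)
      (C : Matrix (Fin m) (Fin δ) F),
      (∀ w : Fin δ → F, (∀ r < δ, w ᵥ* (A ^ r * B) = 0) → w = 0) ∧
      (∀ w : Fin δ → F, (∀ r < δ, (C * A ^ r) *ᵥ w = 0) → w = 0) ∧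
      ∀ r < q + δ / m, C * A ^ r * B = G (r + 1) := by
  have hδ : δ = q * k := by simpa using Fintype.card_congr e
  set H := hankel hm e G with hH
  have hu : IsUnit H.det := isUnit_iff_ne_zero.2 hG
  let Y : Matrix (Fin δ) (Fin k) F :=
    Matrix.of fun p β => G (q + p / m + 1) ⟨p % m, Nat.mod_lt _ hm⟩ β
  -- The coefficients of a linear recurrence expressing the next block column of the Hankel matrix
  -- through the first `q`.
  let Z : Matrix (Fin δ) (Fin k) F := H⁻¹ * Y
  have hZ : H * Z = Y := by
    rw [← Matrix.mul_assoc, Matrix.mul_nonsing_inv _ hu, Matrix.one_mul]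
  have row : ∀ r (α : Fin m), r * m + α < δ →
      ∃ p : Fin δ, (p : ℕ) / m = r ∧ (⟨p % m, Nat.mod_lt _ hm⟩ : Fin m) = α := by
    intro r α h
    refine ⟨⟨r * m + α, h⟩, ?_, Fin.ext ?_⟩
    · simp only
      rw [mul_comm, Nat.mul_add_div hm, Nat.div_eq_of_lt α.2, add_zero]
    · simp only
      rw [mul_comm, Nat.mul_add_mod, Nat.mod_eq_of_lt α.2]
  -- `A` shifts each block of basis vectors to the next one and sends the last block to `Z`; `B` is
  -- the first block.
  let A : Matrix (Fin δ) (Fin δ) F := Matrix.of fun s s' =>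
    if h : (e s').1 + 1 < q then
      (if s = e.symm (⟨(e s').1 + 1, h⟩, (e s').2) then 1 else 0) else Z s (e s').2
  let B : Matrix (Fin δ) (Fin k) F := Matrix.of fun s β => if s = e.symm (⟨0, hq⟩, β) then 1 else 0
  let C : Matrix (Fin m) (Fin δ) F := Matrix.of fun α s => G ((e s).1 + 1) α (e s).2
  have hCA : ∀ r α s, (e s).1 + r < q + δ / m →
      (C * A ^ r) α s = G ((e s).1 + r + 1) α (e s).2 := by
    intro r
    induction r with
    | zero => intro α s _; simp [C]
    | succ r ih =>
      intro α s hs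
      rw [pow_succ, ← Matrix.mul_assoc, Matrix.mul_apply]
      by_cases h : (e s).1 + 1 < q
      · rw [Finset.sum_eq_single_of_mem (e.symm (⟨(e s).1 + 1, h⟩, (e s).2)) (Finset.mem_univ _)]
        · rw [ih _ _ (by simp; omega)]
          simp only [A, Matrix.of_apply, h, dif_pos, Equiv.apply_symm_apply, if_true, mul_one]
          congr 1
          congr 1
          omega
        · intro s' _ hs'
          simp only [A, Matrix.of_apply, h, dif_pos, hs', if_false, mul_zero]
      · have hq' : ((e s).1 : ℕ) + 1 = q := by have := (e s).1.2; omega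
        -- Only complete block rows of `H * Z = Y` are used; this is what limits the realized range
        -- to `q + δ / m`.
        have hr : r < δ / m := by omega
        have hrow : r * m + α < δ := by
          have h1 : (r + 1) * m ≤ δ / m * m := Nat.mul_le_mul_right m hr
          have h2 := Nat.div_mul_le_self δ m
          have h3 := α.2
          rw [Nat.add_mul] at h1
          omega
        obtain ⟨p, hp1, hp2⟩ := row r α hrow
        have h1 := congrFun (congrFun hZ p) (e s).2
        rw [Matrix.mul_apply] at h1
        simp only [hH, hankel, Y, Matrix.of_apply, hp1, hp2] at h1
        have h2 : ((e s).1 : ℕ) + (r + 1) + 1 = q + r + 1 := by omega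
        rw [h2, ← h1]
        refine Finset.sum_congr rfl fun s' _ => ?_
        rw [ih _ _ (by have := (e s').1.2; omega)]
        simp only [A, Matrix.of_apply, h, dif_neg, not_false_eq_true]
  have hAB : ∀ r (hr : r < q) β s, (A ^ r * B) s β = if s = e.symm (⟨r, hr⟩, β) then 1 else 0 := by
    intro r
    induction r with
    | zero => intro hr β s; simp [B]
    | succ r ih =>
      intro hr β s
      rw [pow_succ', Matrix.mul_assoc, Matrix.mul_apply]
      simp only [ih (by omega)]
      simp [A, hr]
  refine ⟨A, B, C, fun w hw => ?_, fun w hw => ?_, fun r hr => ?_⟩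
  · ext s
    have hs := (e s).1.2
    have h1 := congrFun (hw (e s).1 (lt_of_lt_of_le hs (hδ ▸ Nat.le_mul_of_pos_right q hk)))
      (e s).2
    simpa [Matrix.vecMul, dotProduct, hAB _ hs] using h1
  -- The rows of `H` occur among those of the `C * A ^ r`, so an unobservable state lies in the
  -- kernel of `H`.
  · by_contra hne
    apply hG
    rw [← Matrix.exists_mulVec_eq_zero_iff]
    refine ⟨w, hne, ?_⟩
    ext p
    have hp : (p : ℕ) / m < δ := lt_of_le_of_lt (Nat.div_le_self _ _) p.2
    have h1 := congrFun (hw (p / m) hp) ⟨p % m, Nat.mod_lt _ hm⟩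
    refine Eq.trans ?_ h1
    simp only [Matrix.mulVec, dotProduct]
    refine Finset.sum_congr rfl fun s _ => ?_
    rw [hCA]
    · simp [hH, hankel]
    · have h2 := (e s).1.2
      have h3 : (p : ℕ) / m ≤ δ / m := Nat.div_le_div_right p.2.le
      omega
  · ext α β
    rw [Matrix.mul_apply, Finset.sum_eq_single_of_mem (e.symm (⟨0, hq⟩, β)) (Finset.mem_univ _)]
    · rw [hCA _ _ _ (by simpa using hr)]
      simp [B]
    · intro s _ hs
      simp [B, hs]

theorem rank_eq_of_mulVec_injective {F ι : Type*} [Field F] [Fintype ι] {δ : ℕ}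
    (M : Matrix ι (Fin δ) F) (h : ∀ w, M *ᵥ w = 0 → w = 0) : M.rank = δ := by
  have : Function.Injective M.mulVecLin := by
    rw [← LinearMap.ker_eq_bot, LinearMap.ker_eq_bot']
    exact h
  rw [Matrix.rank, LinearMap.finrank_range_of_inj this]
  simp

namespace LinearSystem

variable {F : Type*} [Field F] {n k δ : ℕ}

theorem isObservable_of_forall (S : LinearSystem F n k δ)
    (h : ∀ w : Fin δ → F, (∀ r < δ, (S.C * S.A ^ r) *ᵥ w = 0) → w = 0) : S.IsObservable := by
  refine rank_eq_of_mulVec_injective _ fun w hw => h w fun r hr => ?_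
  ext i
  exact congrFun hw (⟨r, hr⟩, i)

theorem isControllable_of_forall (S : LinearSystem F n k δ)
    (h : ∀ w : Fin δ → F, (∀ r < δ, w ᵥ* (S.A ^ r * S.B) = 0) → w = 0) : S.IsControllable := by
  rw [IsControllable, ← Matrix.rank_transpose]
  refine rank_eq_of_mulVec_injective _ fun w hw => h w fun r hr => ?_
  ext i
  have := congrFun hw (⟨r, hr⟩, i)
  rw [Matrix.mulVec_transpose] at this
  exact this

end LinearSystem

/-! ### Hankel determinants as Toeplitz minors -/

theorem IsNontrivialPair.of_forall_le {m k p : ℕ} {R : Fin p → ℕ × Fin m} {C : Fin p → ℕ × Fin k}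
    (hR : Function.Injective R) (hC : Function.Injective C) (h : ∀ i j, (C j).1 ≤ (R i).1) :
    IsNontrivialPair R C :=
  ⟨hR, hC, fun _ => Finset.card_le_card
    (Finset.monotone_filter_right _ fun i _ hi => lt_of_le_of_lt (h i i) hi)⟩

theorem divMod_injective {δ m : ℕ} (hm : 0 < m) (f : ℕ → ℕ)
    (hf : ∀ a ≤ δ / m, ∀ b ≤ δ / m, f a = f b → a = b) :
    Function.Injective fun p : Fin δ => ((f (p / m), ⟨p % m, Nat.mod_lt _ hm⟩) : ℕ × Fin m) := by
  intro p p' h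
  simp only [Prod.mk.injEq, Fin.mk.injEq] at h
  have h1 := hf _ (Nat.div_le_div_right p.2.le) _ (Nat.div_le_div_right p'.2.le) h.1
  ext
  rw [← Nat.div_add_mod (p : ℕ) m, ← Nat.div_add_mod (p' : ℕ) m, h1, h.2]

section Hankel

variable {F : Type*} [Field F] {K m k q δ : ℕ} {t : F}

theorem IsSuperregular.hankel_det_ne_zero (hm : 0 < m) (e : Fin δ ≃ Fin q × Fin k)
    (ht : IsSuperregular K m k (q + δ / m + 1) t) :
    (hankel hm e (markovParam K m k t)).det ≠ 0 := by
  let R : Fin δ → ℕ × Fin m := fun p => (q + p / m, ⟨p % m, Nat.mod_lt _ hm⟩)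
  -- Reversing the block columns turns Hankel into Toeplitz. All column times are below `q` and all
  -- row times at least `q`, so the minor is nontrivial.
  let C : Fin δ → ℕ × Fin k := fun s => (q - 1 - (e s).1, (e s).2)
  have hR : Function.Injective R :=
    divMod_injective hm (fun a => q + a) fun a _ b _ h => Nat.add_left_cancel h
  have hC : Function.Injective C := by
    intro s s' h
    simp only [C, Prod.mk.injEq] at h
    have h1 := (e s).1.2
    have h2 := (e s').1.2
    exact e.injective (Prod.ext (Fin.ext (by omega)) h.2)
  have h := ht δ R C (.of_forall_le hR hC fun p s => by
    have := Nat.zero_le (p / m)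
    simp only [R, C]
    omega)
    (fun p => by
      have := Nat.div_le_div_right (c := m) p.2.le
      have := Nat.zero_le (p / m)
      simp only [R]
      omega)
    (fun s => by
      have := Nat.zero_le (δ / m)
      simp only [C]
      omega)
  convert h using 1
  unfold toeplitzMinor
  congr 1
  ext p s
  have h1 := (e s).1.2
  have h0 := Nat.zero_le (p / m)
  have h2 : (C s).1 ≤ (R p).1 := by simp only [R, C]; omega
  have h3 : (R p).1 - (C s).1 = (e s).1 + p / m + 1 := by simp only [R, C]; omega
  simp only [Matrix.of_apply, toeplitzEntry, h2, if_true, h3, hankel, R, C]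

theorem IsSuperregular.hankel_transpose_det_ne_zero (hk : 0 < k) (e : Fin δ ≃ Fin q × Fin m)
    (ht : IsSuperregular K m k (δ / k + q + 1) t) :
    (hankel hk e fun i => (markovParam K m k t i)ᵀ).det ≠ 0 := by
  let R : Fin δ → ℕ × Fin m := fun s => (δ / k + 1 + (e s).1, (e s).2)
  -- After transposition the Hankel rows become the Toeplitz columns, so their order is the one
  -- reversed.
  let C : Fin δ → ℕ × Fin k := fun p => (δ / k - p / k, ⟨p % k, Nat.mod_lt _ hk⟩)
  have hC : Function.Injective C :=
    divMod_injective hk (fun a => δ / k - a) fun a _ b _ (h : δ / k - a = δ / k - b) => by omega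
  have hR : Function.Injective R := by
    intro s s' h
    simp only [R, Prod.mk.injEq] at h
    exact e.injective (Prod.ext (Fin.ext (by omega)) h.2)
  have h := ht δ R C (.of_forall_le hR hC fun s p => by
    have := Nat.zero_le (p / k)
    have := Nat.zero_le (δ / k)
    simp only [R, C]; omega)
    (fun s => by
      have := (e s).1.2
      simp only [R]
      omega)
    (fun p => by
      have := Nat.zero_le (p / k)
      have := Nat.zero_le (δ / k)
      simp only [C]
      omega)
  rw [← Matrix.det_transpose]
  convert h using 1
  unfold toeplitzMinor
  congr 1
  ext s p
  have h1 : (p : ℕ) / k ≤ δ / k := Nat.div_le_div_right p.2.le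
  have h0 := Nat.zero_le (p / k)
  have h2 : (C p).1 ≤ (R s).1 := by simp only [R, C]; omega
  have h3 : (R s).1 - (C p).1 = (e s).1 + p / k + 1 := by simp only [R, C]; omega
  simp only [Matrix.of_apply, toeplitzEntry, h2, if_true, h3, hankel, R, C, Matrix.transpose_apply]

end Hankel

/-! ### Construction of the code -/

/-- The first Markov parameters have a minimal realization with `δ` states. -/
theorem IsSuperregular.exists_linearSystem {F : Type*} [Field F] {K n k δ : ℕ} {t : F} (hk : 0 < k)
    (hkn : k < n) (hδ : 0 < δ) (hdvd : k ∣ δ ∨ (n - k) ∣ δ)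
    (ht : IsSuperregular K (n - k) k (δ / k + δ / (n - k) + 1) t) :
    ∃ S : LinearSystem F n k δ, S.IsControllable ∧ S.IsObservable ∧
      S.D = markovParam K (n - k) k t 0 ∧
      ∀ r < δ / k + δ / (n - k), S.C * S.A ^ r * S.B = markovParam K (n - k) k t (r + 1) := by
  have hm : 0 < n - k := Nat.sub_pos_of_lt hkn
  rcases hdvd with hd | hd
  · let e : Fin δ ≃ Fin (δ / k) × Fin k :=
      (finCongr (Nat.div_mul_cancel hd).symm).trans finProdFinEquiv.symm
    obtain ⟨A, B, C, hc, ho, hM⟩ := exists_partial_realization hm hk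
      (Nat.div_pos (Nat.le_of_dvd hδ hd) hk) e _ (ht.hankel_det_ne_zero hm e)
    let S : LinearSystem F n k δ := ⟨A, B, C, markovParam K (n - k) k t 0⟩
    exact ⟨S, S.isControllable_of_forall hc, S.isObservable_of_forall ho, rfl, hM⟩
  · let e : Fin δ ≃ Fin (δ / (n - k)) × Fin (n - k) :=
      (finCongr (Nat.div_mul_cancel hd).symm).trans finProdFinEquiv.symm
    obtain ⟨A, B, C, hc, ho, hM⟩ := exists_partial_realization hk hm
      (Nat.div_pos (Nat.le_of_dvd hδ hd) hm) e _ (ht.hankel_transpose_det_ne_zero hk e)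
    -- The dual system: transposition exchanges controllability and observability.
    let S : LinearSystem F n k δ := ⟨Aᵀ, Cᵀ, Bᵀ, markovParam K (n - k) k t 0⟩
    refine ⟨S, S.isControllable_of_forall fun w hw => ho w fun r hr => ?_,
      S.isObservable_of_forall fun w hw => hc w fun r hr => ?_, rfl, fun r hr => ?_⟩
    · rw [← hw r hr, ← Matrix.vecMul_transpose, Matrix.transpose_mul, Matrix.transpose_pow]
    · rw [← hw r hr, ← Matrix.mulVec_transpose, Matrix.transpose_mul, Matrix.transpose_pow]
    · rw [← (markovParam K (n - k) k t (r + 1)).transpose_transpose, ← hM r (by omega),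
        Matrix.transpose_mul, Matrix.transpose_mul, Matrix.transpose_pow, Matrix.mul_assoc]

theorem mainTheorem6 (n k δ : ℕ) (hk : 0 < k) (hkn : k < n) (hδ : 0 < δ)
    (hdvd : k ∣ δ ∨ (n - k) ∣ δ) :
    ∃ N : ℕ, ∀ (F : Type*) [Field F] [Fintype F] [DecidableEq F], N ≤ Fintype.card F →
      ∃ 𝒞 : Set (CodeSeq F n k),
        IsConvolutionalCode n k δ 𝒞 ∧ HasMaximumDistanceProfile δ 𝒞 := by
  obtain ⟨N, hN⟩ := exists_isSuperregular (Nat.sub_le n k) hkn.le (δ / k + δ / (n - k) + 1)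
  refine ⟨N, fun F _ _ _ hF => ?_⟩
  obtain ⟨t, ht⟩ := hN F hF
  obtain ⟨S, hc, ho, hD, hM⟩ := ht.exists_linearSystem hk hkn hδ hdvd
  exact ⟨S.code, ⟨S, hc, ho, rfl⟩, S.hasMaximumDistanceProfile hk hD hM ht⟩
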